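/- Let $d\ge 0$ be an integer, let $\|\cdot\|$ be the Euclidean norm on $\mathbb R^d$, and let $\|\cdot\|_S$ be the spectral norm (largest singular value) of a matrix. Let $f=(f_1,\dots,f_d):\mathbb R^d\to\mathbb R^d$ be twice continuously differentiable and globally Lipschitz continuous, and suppose that the equation $f(\theta)=0$ has a unique solution $\theta^*$. For $\theta\in\mathbb R^d$ let $s(\cdot,\theta)$ denote the unique solution on $[0,\infty)$ of $$\frac{d}{dt}s(t,\theta)=f(s(t,\theta)),\qquad s(0,\theta)=\theta .$$ Suppose that $\theta^*$ is globally exponentially stable, i.e. there are constants $\mu\ge 1$ and $\gamma>0$ such that $$\|s(t,\theta)-\theta^*\|\le \mu\,\|\theta-\theta^*\|\,e^{-\gamma t}\qquad\text{for all }t\ge 0,\ \theta\in\mathbb R^d, \tag{1}$$ and that there is a finite constant $K$ such that $$\|\nabla^2 f_i(\theta)\|_S\cdot\|\theta-\theta^*\|\le K\qquad\text{for all } i\in\{1,\dots,d\},\ \theta\in\mathbb R^d .$$ Then there is a $C^2$ function $V:\mathbb R^d\to[0,\infty)$ for which there exist constants $a,b,c>0$ and a finite constant $M$ such that, for all $\theta\in\mathbb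 R^d$, with $\dot V(\theta)=\langle\nabla V(\theta),f(\theta)\rangle$, $$a\|\theta-\theta^*\|^2\le V(\theta)\le b\|\theta-\theta^*\|^2,\qquad \dot V(\theta)\le -c\|\theta-\theta^*\|^2,\qquad \|\nabla^2V(\theta)\|_S\le 2M .$$ Moreover, for every $\mu\ge1$ and $\gamma>0$ satisfying (1), every $\kappa$ with $0<\kappa<\gamma$, and every finite $T>0$ with $T\ge \frac{\ln\mu}{\gamma-\kappa}$, the function $$V(\theta)=\int_0^T e^{2\kappa\tau}\,\|s(\tau,\theta)-\theta^*\|^2\,d\tau$$ is such a function (with $a,b,c,M$ allowed to depend on all the data, including $\kappa$ and $T$). -/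

import Mathlib

/-- `s t θ` is the solution at time `t ≥ 0` of `θ' = f θ` with initial value `θ`
(the values of `s` at negative times play no role). -/
def IsSolutionMap {d : ℕ}
    (f : EuclideanSpace ℝ (Fin d) → EuclideanSpace ℝ (Fin d))
    (s : ℝ → EuclideanSpace ℝ (Fin d) → EuclideanSpace ℝ (Fin d)) : Prop :=
  ∀ θ, s 0 θ = θ ∧ IsIntegralCurveOn (fun t => s t θ) (fun _ => f) (Set.Ici 0)

/-- All solutions `x` on `[0, ∞)` of `θ' = f θ` satisfy
`‖x t - θs‖ ≤ μ ‖x 0 - θs‖ exp (-γ t)` for all `t ≥ 0`. -/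
def HasExponentialBound {d : ℕ}
    (f : EuclideanSpace ℝ (Fin d) → EuclideanSpace ℝ (Fin d))
    (θs : EuclideanSpace ℝ (Fin d)) (μ γ : ℝ) : Prop :=
  ∀ x : ℝ → EuclideanSpace ℝ (Fin d), IsIntegralCurveOn x (fun _ => f) (Set.Ici 0) →
    ∀ t : ℝ, 0 ≤ t → ‖x t - θs‖ ≤ μ * ‖x 0 - θs‖ * Real.exp (-γ * t)

/-- `θs` is a globally exponentially stable equilibrium of `θ' = f θ`. -/
def IsGloballyExponentiallyStable {d : ℕ}
    (f : EuclideanSpace ℝ (Fin d) → EuclideanSpace ℝ (Fin d))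
    (θs : EuclideanSpace ℝ (Fin d)) : Prop :=
  ∃ μ γ : ℝ, 1 ≤ μ ∧ 0 < γ ∧ HasExponentialBound f θs μ γ

/-- The Hessian `∇²g(θ)`, as the linear operator given by the derivative of the gradient at `θ`.
Its operator norm for the Euclidean norm is the spectral norm of the Hessian matrix. -/
noncomputable def hessian {d : ℕ} (g : EuclideanSpace ℝ (Fin d) → ℝ)
    (θ : EuclideanSpace ℝ (Fin d)) :
    EuclideanSpace ℝ (Fin d) →L[ℝ] EuclideanSpace ℝ (Fin d) :=
  fderiv ℝ (gradient g) θ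

/-- The derivative `⟨∇V(θ), f(θ)⟩` of `V` along the trajectories of `θ' = f θ`. -/
noncomputable def orbitalDerivative {d : ℕ}
    (f : EuclideanSpace ℝ (Fin d) → EuclideanSpace ℝ (Fin d))
    (V : EuclideanSpace ℝ (Fin d) → ℝ) (θ : EuclideanSpace ℝ (Fin d)) : ℝ :=
  inner ℝ (gradient V θ) (f θ)

/-- `V` is a nonnegative `C²` function with quadratic upper and lower bounds, quadratic decay
along trajectories, and globally bounded Hessian. -/
structure IsLyapunovWithBoundedHessian {d : ℕ}
    (f : EuclideanSpace ℝ (Fin d) → EuclideanSpace ℝ (Fin d))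
    (θs : EuclideanSpace ℝ (Fin d)) (V : EuclideanSpace ℝ (Fin d) → ℝ) : Prop where
  contDiff : ContDiff ℝ 2 V
  nonneg : ∀ θ, 0 ≤ V θ
  bounds : ∃ a b c M : ℝ, 0 < a ∧ 0 < b ∧ 0 < c ∧
    (∀ θ, a * ‖θ - θs‖ ^ 2 ≤ V θ ∧ V θ ≤ b * ‖θ - θs‖ ^ 2) ∧
    (∀ θ, orbitalDerivative f V θ ≤ -c * ‖θ - θs‖ ^ 2) ∧
    ∀ θ, ‖hessian V θ‖ ≤ 2 * M

/-- The Corless–Glielmo finite-horizon integral `∫₀ᵀ exp (2κτ) ‖s(τ, θ) - θs‖² dτ`. -/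
noncomputable def corlessGlielmo {d : ℕ}
    (s : ℝ → EuclideanSpace ℝ (Fin d) → EuclideanSpace ℝ (Fin d))
    (θs : EuclideanSpace ℝ (Fin d)) (κ T : ℝ) (θ : EuclideanSpace ℝ (Fin d)) : ℝ :=
  ∫ τ in (0 : ℝ)..T, Real.exp (2 * κ * τ) * ‖s τ θ - θs‖ ^ 2

/-! The work lies in the smoothness of $V$ and its Hessian bound, obtained by viewing a whole
trajectory on $[0,T]$ as one point of a Banach space. In the coordinates
$p(\theta)(t)=e^{-rt}s(t,\theta)$ with $r=2L+1$, the integral equation reads $p=c\,\theta+\Psi(p)$,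
where $\Psi$ is a $C^2$ map of $C([0,T],\mathbb R^d)$ with Lipschitz constant $1/2$. The inverse
function theorem makes $p$ a $C^2$ map. Differentiating the equation bounds $Dp$ uniformly and
$D^2p$ by a constant times $\sup_t\|D^2f(s(t,\theta))\|$. Since $V$ is the squared $L^2$ norm of an
affine image of $p$, this gives $\|D^2V\|\le C(1+\sqrt V\,\sup_t\|D^2f(s(t,\theta))\|)$. Here $\sqrt
V=O(\|\theta-\theta^*\|)$, while the hypothesis on $\nabla^2f_i$ and a backward Grönwall estimate
make the supremum $O(1/\|\theta-\theta^*\|)$; the two factors cancel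
(`IsSolutionMap.isLyapunovWithBoundedHessian_corlessGlielmo`). For the decay, $\dot V=-2\kappa
V+e^{2\kappa T}\|s(T,\theta)-\theta^*\|^2-\|\theta-\theta^*\|^2$, and the choice of $T$ makes the
boundary terms nonpositive. -/

open Set Filter Topology

/-! ### Superposition operators on spaces of continuous functions -/

namespace ContinuousMap

universe u

variable {α : Type*} [TopologicalSpace α] [CompactSpace α]
  {E F : Type u} [NormedAddCommGroup E] [NormedSpace ℝ E] [NormedAddCommGroup F] [NormedSpace ℝ F]

/-- Pointwise application of a continuous family of continuous linear maps to a continuous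
function. -/
noncomputable def pointwiseApply (α : Type*) [TopologicalSpace α] [CompactSpace α]
    (E F : Type*) [NormedAddCommGroup E] [NormedSpace ℝ E] [NormedAddCommGroup F]
    [NormedSpace ℝ F] : C(α, E →L[ℝ] F) →L[ℝ] C(α, E) →L[ℝ] C(α, F) :=
  LinearMap.mkContinuous₂
    (LinearMap.mk₂ ℝ (fun (a : C(α, E →L[ℝ] F)) (u : C(α, E)) =>
        (⟨fun t => a t (u t), a.continuous.clm_apply u.continuous⟩ : C(α, F)))
      (fun a b u => by ext t; simp) (fun r a u => by ext t; simp)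
      (fun a u v => by ext t; simp) (fun r a u => by ext t; simp))
    1 fun a u => by
      rw [one_mul]
      refine (ContinuousMap.norm_le _ (mul_nonneg (norm_nonneg a) (norm_nonneg u))).2 fun t => ?_
      exact (a t).le_of_opNorm_le_of_le (a.norm_coe_le_norm t) (u.norm_coe_le_norm t)

@[simp] theorem pointwiseApply_apply (a : C(α, E →L[ℝ] F)) (u : C(α, E)) (t : α) :
    pointwiseApply α E F a u t = a t (u t) := rfl

theorem norm_pointwiseApply_le (a : C(α, E →L[ℝ] F)) : ‖pointwiseApply α E F a‖ ≤ ‖a‖ := by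
  refine ContinuousLinearMap.opNorm_le_bound _ (norm_nonneg a) fun u => ?_
  refine (ContinuousMap.norm_le _ (mul_nonneg (norm_nonneg a) (norm_nonneg u))).2 fun t => ?_
  exact (a t).le_of_opNorm_le_of_le (a.norm_coe_le_norm t) (u.norm_coe_le_norm t)

theorem hasFDerivAt_comp {f : C(E, F)} {f' : C(E, E →L[ℝ] F)} (hf : ∀ x, HasFDerivAt f (f' x) x)
    (u : C(α, E)) :
    HasFDerivAt (fun u : C(α, E) => f.comp u) (pointwiseApply α E F (f'.comp u)) u := by
  rw [hasFDerivAt_iff_isLittleO, Asymptotics.isLittleO_iff]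
  intro ε hε
  -- Compactness of the range of `u` gives one `δ` for all `t`, with only one of the two points
  -- required to lie in the range. This works even where `E` is not locally compact.
  have hunif := (isCompact_range u.continuous).uniformContinuousAt_of_continuousAt f'
    (fun a _ => f'.continuous.continuousAt) (Metric.dist_mem_uniformity hε)
  obtain ⟨δ, hδ, hδ'⟩ := Metric.mem_uniformity_dist.1 hunif
  filter_upwards [Metric.ball_mem_nhds u hδ] with v hv
  refine (ContinuousMap.norm_le _ (by positivity)).2 fun t => ?_
  have hvt : v t ∈ Metric.ball (u t) δ := lt_of_le_of_lt (ContinuousMap.dist_apply_le_dist t) hv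
  have key := (convex_ball (u t) δ).norm_image_sub_le_of_norm_hasFDerivWithin_le' (f := f)
    (f' := f') (φ := f' (u t)) (C := ε) (fun x _ => (hf x).hasFDerivWithinAt)
    (fun x hx => by
      have h : dist (f' (u t)) (f' x) < ε := hδ' (by rw [dist_comm]; exact hx) ⟨t, rfl⟩
      rw [← dist_eq_norm, dist_comm]
      exact h.le)
    (Metric.mem_ball_self hδ) hvt
  simp only [coe_sub, coe_comp, Pi.sub_apply, Function.comp_apply, pointwiseApply_apply]
  exact key.trans (by gcongr; exact (v - u).norm_coe_le_norm t)

/-- The derivative is a fixed linear map applied to the superposition operator of `fderiv ℝ f`, so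
induction on `n` works provided the codomain varies: it passes from `F` to `E →L[ℝ] F`. Hence the
common universe of `E` and `F`. -/
theorem contDiff_comp {n : ℕ} : ∀ {F : Type u} [NormedAddCommGroup F] [NormedSpace ℝ F]
    {f : C(E, F)}, ContDiff ℝ n f → ContDiff ℝ n (fun u : C(α, E) => f.comp u) := by
  induction n with
  | zero =>
    intro F _ _ f _
    exact contDiff_zero.2 (ContinuousMap.continuous_postcomp f)
  | succ n ih =>
    intro F _ _ f hf
    rw [Nat.cast_add_one, contDiff_succ_iff_fderiv] at hf
    obtain ⟨h1, -, h2⟩ := hf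
    have hd := hasFDerivAt_comp (α := α) (f' := ⟨fderiv ℝ f, h2.continuous⟩)
      (fun x => (h1 x).hasFDerivAt)
    rw [Nat.cast_add_one, contDiff_succ_iff_fderiv]
    refine ⟨fun u => (hd u).differentiableAt, by simp, ?_⟩
    rw [funext fun u => (hd u).fderiv]
    exact (pointwiseApply α E F).contDiff.comp (ih (f := ⟨fderiv ℝ f, h2.continuous⟩) h2)

/-! ### The exponentially weighted Picard operator -/

/-- Multiplication of continuous functions by a fixed continuous scalar weight. -/
noncomputable def weight (E : Type*) [NormedAddCommGroup E] [NormedSpace ℝ E] (g : C(α, ℝ)) :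
    C(α, E) →L[ℝ] C(α, E) :=
  pointwiseApply α E E
    ⟨fun t => g t • ContinuousLinearMap.id ℝ E, g.continuous.smul continuous_const⟩

@[simp] theorem weight_apply (g : C(α, ℝ)) (u : C(α, E)) (t : α) : weight E g u t = g t • u t := rfl

/-- The primitive vanishing at `0` of a continuous function on `[0, T]`. -/
noncomputable def primitive (E : Type*) [NormedAddCommGroup E] [NormedSpace ℝ E]
    {T : ℝ} (hT : 0 ≤ T) : C(Icc 0 T, E) →L[ℝ] C(Icc 0 T, E) :=
  LinearMap.mkContinuous
    { toFun := fun w => ⟨fun t => ∫ τ in (0 : ℝ)..t, Set.IccExtend hT w τ,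
        (intervalIntegral.continuous_primitive
          (fun a b => (w.continuous.Icc_extend' (h := hT)).intervalIntegrable a b) 0).comp
          continuous_subtype_val⟩
      map_add' := fun v w => by
        ext t
        exact intervalIntegral.integral_add ((v.continuous.Icc_extend').intervalIntegrable _ _)
          ((w.continuous.Icc_extend').intervalIntegrable _ _)
      map_smul' := fun c w => by
        ext t
        exact intervalIntegral.integral_smul c _ }
    T fun w => by
      refine (ContinuousMap.norm_le _ (mul_nonneg hT (norm_nonneg w))).2 fun t => ?_
      have h := intervalIntegral.norm_integral_le_of_norm_le_const (a := (0 : ℝ)) (b := t)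
        (f := Set.IccExtend hT w) (C := ‖w‖) fun τ _ => w.norm_coe_le_norm _
      refine h.trans ?_
      rw [sub_zero, abs_of_nonneg t.2.1, mul_comm]
      exact mul_le_mul_of_nonneg_right t.2.2 (norm_nonneg w)

theorem primitive_apply {T : ℝ} (hT : 0 ≤ T) (w : C(Icc 0 T, E)) (t : Icc 0 T) :
    primitive E hT w t = ∫ τ in (0 : ℝ)..t, Set.IccExtend hT w τ := rfl

/-- The exponential weight `t ↦ exp (r t)` on `[0, T]`. -/
noncomputable def expWeight (T r : ℝ) : C(Icc 0 T, ℝ) :=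
  ⟨fun t => Real.exp (r * t), by fun_prop⟩

@[simp] theorem expWeight_apply (T r : ℝ) (t : Icc 0 T) : expWeight T r t = Real.exp (r * t) := rfl

/-- The Picard operator `v ↦ exp (-r t) ∫₀ᵗ f (exp (r τ) v τ) dτ`, in exponentially weighted
coordinates. -/
noncomputable def weightedPicard {T : ℝ} (hT : 0 ≤ T) (r : ℝ) (f : C(E, E)) (v : C(Icc 0 T, E)) :
    C(Icc 0 T, E) :=
  weight E (expWeight T (-r)) (primitive E hT (f.comp (weight E (expWeight T r) v)))

/-- Integrating $c\,e^{r\tau}$ gains a factor $1/r$, and the outer weight cancels the remaining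
growth. The bound does not depend on `T`, so a large `r` gives a contraction on the whole interval
at once. -/
theorem norm_weight_primitive_le {T : ℝ} (hT : 0 ≤ T) {r c : ℝ} (hr : 0 < r) (hc : 0 ≤ c)
    (w : C(Icc 0 T, E)) (hw : ∀ τ : Icc 0 T, ‖w τ‖ ≤ c * Real.exp (r * τ)) :
    ‖weight E (expWeight T (-r)) (primitive E hT w)‖ ≤ c / r := by
  refine (ContinuousMap.norm_le _ (by positivity)).2 fun t => ?_
  rw [weight_apply, norm_smul, expWeight_apply, Real.norm_eq_abs, Real.abs_exp, primitive_apply]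
  have hint : ∫ τ in (0 : ℝ)..t, c * Real.exp (r * τ) = c / r * (Real.exp (r * t) - 1) := by
    have := intervalIntegral.integral_eq_sub_of_hasDerivAt (a := (0 : ℝ)) (b := t)
      (f := fun τ => c / r * Real.exp (r * τ)) (f' := fun τ => c * Real.exp (r * τ))
      (fun x _ => by
        have h := (((hasDerivAt_id x).const_mul r).exp).const_mul (c / r)
        refine h.congr_deriv ?_
        simp only [id, mul_one]
        field_simp)
      (Continuous.intervalIntegrable (by fun_prop) _ _)
    rw [this]
    simp
    ring
  have h1 : ‖∫ τ in (0 : ℝ)..t, Set.IccExtend hT w τ‖ ≤ c / r * (Real.exp (r * t) - 1) := by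
    rw [← hint]
    refine intervalIntegral.norm_integral_le_of_norm_le t.2.1 ?_
      (Continuous.intervalIntegrable (by fun_prop) _ _)
    refine Eventually.of_forall fun τ hτ => ?_
    have hmem : τ ∈ Icc 0 T := ⟨hτ.1.le, hτ.2.trans t.2.2⟩
    rw [Set.IccExtend_of_mem hT _ hmem]
    exact hw ⟨τ, hmem⟩
  calc Real.exp (-r * t) * ‖∫ τ in (0 : ℝ)..t, Set.IccExtend hT w τ‖
      ≤ Real.exp (-r * t) * (c / r * Real.exp (r * t)) := by
        gcongr
        refine h1.trans ?_
        gcongr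
        linarith
    _ = c / r := by
        rw [mul_left_comm, ← Real.exp_add]
        simp

theorem lipschitzWith_weightedPicard {T : ℝ} (hT : 0 ≤ T) {r : NNReal} (hr : 0 < r) {f : C(E, E)}
    {L : NNReal} (hf : LipschitzWith L f) : LipschitzWith (L / r) (weightedPicard hT r f) := by
  refine LipschitzWith.of_dist_le_mul fun v w => ?_
  rw [dist_eq_norm, dist_eq_norm]
  have := norm_weight_primitive_le hT (r := r) (c := L * ‖v - w‖) (by exact_mod_cast hr)
    (by positivity)
    (f.comp (weight E (expWeight T r) v) - f.comp (weight E (expWeight T r) w)) fun τ => by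
      have h := hf.dist_le_mul (weight E (expWeight T r) v τ) (weight E (expWeight T r) w τ)
      rw [dist_eq_norm, dist_eq_norm, weight_apply, weight_apply, ← smul_sub, norm_smul,
        expWeight_apply, Real.norm_eq_abs, Real.abs_exp] at h
      refine h.trans ?_
      rw [mul_assoc, mul_comm ‖v - w‖]
      gcongr
      exact (v - w).norm_coe_le_norm τ
  rw [map_sub, map_sub] at this
  refine this.trans (le_of_eq ?_)
  push_cast
  ring

theorem norm_fderiv_comp_le {f : C(E, F)} (hf : ContDiff ℝ 1 f) (u : C(α, E)) {c : ℝ} (hc : 0 ≤ c)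
    (hu : ∀ t, ‖fderiv ℝ f (u t)‖ ≤ c) : ‖fderiv ℝ (fun u : C(α, E) => f.comp u) u‖ ≤ c := by
  obtain ⟨h1, h2⟩ := contDiff_one_iff_fderiv.1 hf
  rw [(hasFDerivAt_comp (f' := ⟨fderiv ℝ f, h2⟩) (fun x => (h1 x).hasFDerivAt) u).fderiv]
  exact (norm_pointwiseApply_le _).trans ((ContinuousMap.norm_le _ hc).2 hu)

/-- The target `Y` is arbitrary so that the estimate can be reused one order higher, with `B` taking
values in a space of operators. -/
theorem exists_norm_fderiv_clm_comp_le {Y : Type*} [NormedAddCommGroup Y] [NormedSpace ℝ Y]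
    (A : C(α, E) →L[ℝ] C(α, E)) (B : C(α, F) →L[ℝ] Y) {f : C(E, F)} (hf : ContDiff ℝ 1 f) :
    ∃ C, 0 ≤ C ∧ ∀ (v : C(α, E)) (c : ℝ), 0 ≤ c → (∀ τ, ‖fderiv ℝ f (A v τ)‖ ≤ c) →
      ‖fderiv ℝ (fun v => B (f.comp (A v))) v‖ ≤ C * c := by
  refine ⟨‖B‖ * ‖A‖, by positivity, fun v c hc hv => ?_⟩
  have hd : DifferentiableAt ℝ (fun u : C(α, E) => f.comp u) (A v) :=
    (contDiff_comp (n := 1) hf).differentiable (by simp) _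
  have h := B.hasFDerivAt.comp v (hd.hasFDerivAt.comp v A.hasFDerivAt)
  calc ‖fderiv ℝ (fun v => B (f.comp (A v))) v‖
      = ‖B ∘L (fderiv ℝ (fun u : C(α, E) => f.comp u) (A v) ∘L A)‖ := by rw [← h.fderiv]; rfl
    _ ≤ ‖B‖ * (c * ‖A‖) := by
        refine (ContinuousLinearMap.opNorm_comp_le _ _).trans ?_
        gcongr
        refine (ContinuousLinearMap.opNorm_comp_le _ _).trans ?_
        gcongr
        exact norm_fderiv_comp_le hf _ hc hv
    _ = ‖B‖ * ‖A‖ * c := by ring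

/-- The second derivative of the superposition operator `v ↦ B (f ∘ A v)` is controlled by the
second derivative of `f` along `A v`. -/
theorem exists_norm_fderiv_fderiv_comp_le (A B : C(α, E) →L[ℝ] C(α, E)) {f : C(E, E)}
    (hf : ContDiff ℝ 2 f) : ∃ C, 0 ≤ C ∧ ∀ (v : C(α, E)) (c : ℝ), 0 ≤ c →
      (∀ τ, ‖fderiv ℝ (fderiv ℝ f) (A v τ)‖ ≤ c) →
      ‖fderiv ℝ (fderiv ℝ fun v => B (f.comp (A v))) v‖ ≤ C * c := by
  obtain ⟨h1, -, h2⟩ := contDiff_succ_iff_fderiv.1 (show ContDiff ℝ (1 + 1) f by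
    rwa [one_add_one_eq_two])
  -- The derivative is again of the form "linear map after superposition after `A`", now with
  -- `fderiv ℝ f` as nonlinearity; the first-order estimate then applies to it.
  have hd1 : fderiv ℝ (fun v : C(α, E) => B (f.comp (A v))) = fun v =>
      ((ContinuousLinearMap.compL ℝ C(α, E) C(α, E) C(α, E) B) ∘L
      ((ContinuousLinearMap.compL ℝ C(α, E) C(α, E) C(α, E)).flip A) ∘L pointwiseApply α E E)
        (comp ⟨fderiv ℝ f, h2.continuous⟩ (A v)) := funext fun v =>
    (B.hasFDerivAt.comp v ((hasFDerivAt_comp (f' := ⟨fderiv ℝ f, h2.continuous⟩)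
      (fun x => (h1 x).hasFDerivAt) (A v)).comp v A.hasFDerivAt)).fderiv
  rw [hd1]
  exact exists_norm_fderiv_clm_comp_le A _ (f := ⟨fderiv ℝ f, h2.continuous⟩) h2

variable [CompleteSpace E]

/-- In exponentially weighted coordinates, integral curves on `[0, T]` are fixed points of the
affine Picard operator. -/
theorem eq_add_weightedPicard_of_isIntegralCurveOn {T : ℝ} (hT : 0 ≤ T) (r : ℝ) {f : C(E, E)}
    {x : ℝ → E} (hx : IsIntegralCurveOn x (fun _ => f) (Ici 0)) {v : C(Icc 0 T, E)}
    (hv : ∀ t : Icc 0 T, v t = Real.exp (-r * t) • x t) :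
    v = weight E (expWeight T (-r)) (const _ (x 0)) + weightedPicard hT r f v := by
  have hA (t : Icc 0 T) : weight E (expWeight T r) v t = x t := by
    rw [weight_apply, hv, smul_smul, expWeight_apply, ← Real.exp_add]
    simp
  have hxc : ContinuousOn x (Ici 0) := hx.continuousOn
  ext t
  have hint : ∫ τ in (0 : ℝ)..t, Set.IccExtend hT (f.comp (weight E (expWeight T r) v)) τ
      = x t - x 0 := by
    refine intervalIntegral.integral_eq_sub_of_hasDerivAt_of_le t.2.1
      (hxc.mono Icc_subset_Ici_self) (fun τ hτ => ?_)
      ((Continuous.Icc_extend' (ContinuousMap.continuous _)).intervalIntegrable _ _)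
    rw [Set.IccExtend_of_mem hT _ ⟨hτ.1.le, hτ.2.le.trans t.2.2⟩, comp_apply, hA]
    exact (hx τ hτ.1.le).hasDerivAt (Ici_mem_nhds hτ.1)
  rw [add_apply, weightedPicard, weight_apply, weight_apply, primitive_apply, hint, const_apply,
    ← smul_add, hv, expWeight_apply]
  simp

theorem exists_isIntegralCurveOn_Icc {T : ℝ} (hT : 0 ≤ T) {f : C(E, E)} {L : NNReal}
    (hf : LipschitzWith L f) (x₀ : E) :
    ∃ x : ℝ → E, x 0 = x₀ ∧ ∀ t ∈ Icc 0 T, HasDerivAt x (f (x t)) t := by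
  have hr : (0 : NNReal) < L + 1 := by positivity
  set r : NNReal := L + 1
  have hL := lipschitzWith_weightedPicard hT hr hf
  have hcontr : ContractingWith (L / r) fun v : C(Icc 0 T, E) =>
      weight E (expWeight T (-r)) (const _ x₀) + weightedPicard hT r f v := by
    refine ⟨(div_lt_one hr).2 (lt_add_one L), LipschitzWith.of_dist_le_mul fun v w => ?_⟩
    rw [dist_add_left]
    exact hL.dist_le_mul v w
  obtain ⟨v, hv⟩ : ∃ v : C(Icc 0 T, E), weight E (expWeight T (-r)) (const _ x₀) +
      weightedPicard hT r f v = v :=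
    ⟨hcontr.fixedPoint, hcontr.fixedPoint_isFixedPt⟩
  set w := f.comp (weight E (expWeight T r) v) with hw
  -- The integrand is extended continuously to all of `ℝ`, so the derivative is two-sided even at
  -- `0` and `T`.
  refine ⟨fun t => x₀ + ∫ τ in (0 : ℝ)..t, Set.IccExtend hT w τ, by simp, fun t ht => ?_⟩
  have hwt : x₀ + ∫ τ in (0 : ℝ)..t, Set.IccExtend hT w τ =
      weight E (expWeight T r) v ⟨t, ht⟩ := by
    rw [← hv, weight_apply, add_apply, weightedPicard, weight_apply, weight_apply,
      primitive_apply, ← hw, ← smul_add, smul_smul, expWeight_apply, expWeight_apply,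
      ← Real.exp_add]
    simp
  have hcont : Continuous (Set.IccExtend hT w) := w.continuous.Icc_extend'
  have h := (intervalIntegral.integral_hasDerivAt_right (hcont.intervalIntegrable 0 t)
    (hcont.stronglyMeasurableAtFilter _ _) hcont.continuousAt).const_add x₀
  refine h.congr_deriv ?_
  simp only [hwt]
  rw [Set.IccExtend_of_mem hT _ ht, hw, comp_apply]

end ContinuousMap

/-! ### Smooth dependence of fixed points on a parameter -/

section FixedPoint

variable {E X : Type*} [NormedAddCommGroup E] [NormedSpace ℝ E] [NormedAddCommGroup X]
  [NormedSpace ℝ X] {Ψ : X → X} {c : E →L[ℝ] X} {p : E → X}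

/-- The fixed point of a smooth family of affine perturbations of a contraction depends smoothly
on the parameter. -/
theorem contDiff_of_eq_add_contraction [CompleteSpace X] {n : WithTop ℕ∞} (hn : n ≠ 0)
    (hΨ : ContDiff ℝ n Ψ) (hlip : LipschitzWith (1 / 2) Ψ) (hp : ∀ θ, p θ = c θ + Ψ (p θ)) :
    ContDiff ℝ n p := by
  rw [contDiff_iff_contDiffAt]
  intro θ
  have hd : DifferentiableAt ℝ Ψ (p θ) := hΨ.differentiable hn _
  have hnorm : ‖fderiv ℝ Ψ (p θ)‖ < 1 :=
    (norm_fderiv_le_of_lipschitz ℝ hlip).trans_lt (by norm_num)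
  -- By the Neumann series the derivative of `id - Ψ` is invertible.
  let e : X ≃L[ℝ] X := ContinuousLinearEquiv.unitsEquiv ℝ X (Units.oneSub _ hnorm)
  have hG : ContDiffAt ℝ n (fun v => v - Ψ v) (p θ) := (contDiff_id.sub hΨ).contDiffAt
  have hG' : HasFDerivAt (fun v => v - Ψ v) (e : X →L[ℝ] X) (p θ) :=
    (hasFDerivAt_id (p θ)).sub hd.hasFDerivAt
  have hGp (θ' : E) : p θ' - Ψ (p θ') = c θ' := sub_eq_iff_eq_add.2 (hp θ')
  have hinj : Function.Injective fun v => v - Ψ v := by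
    intro v w hvw
    have h1 := hlip.dist_le_mul v w
    have h2 : dist v w = dist (Ψ v) (Ψ w) := by
      rw [dist_eq_norm, dist_eq_norm, sub_eq_sub_iff_sub_eq_sub.1 hvw]
    rw [← h2] at h1
    push_cast at h1
    exact dist_le_zero.1 (by linarith)
  have hloc : ContDiffAt ℝ n (hG.localInverse hG' hn) (c θ) := by
    rw [← hGp θ]
    exact hG.to_localInverse hG' hn
  refine (hloc.comp θ c.contDiff.contDiffAt).congr_of_eventuallyEq ?_
  let Φ := hG.toOpenPartialHomeomorph (fun v => v - Ψ v) hG' hn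
  have htgt : Φ.target ∈ 𝓝 (c θ) := by
    rw [← hGp θ]
    exact Φ.open_target.mem_nhds (hG.image_mem_toOpenPartialHomeomorph_target hG' hn)
  filter_upwards [c.continuous.continuousAt.preimage_mem_nhds htgt] with θ' hθ'
  -- Global injectivity of `id - Ψ` identifies `p` with the local inverse composed with `c`, without
  -- prior knowledge that `p` is continuous.
  exact hinj ((hGp θ').trans (Φ.right_inv hθ').symm)

theorem norm_fderiv_le_of_eq_add_contraction (hΨ : Differentiable ℝ Ψ)
    (hlip : LipschitzWith (1 / 2) Ψ) (hp : ∀ θ, p θ = c θ + Ψ (p θ)) (hpd : Differentiable ℝ p)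
    (θ : E) : ‖fderiv ℝ p θ‖ ≤ 2 * ‖c‖ := by
  have hd : fderiv ℝ p θ = c + fderiv ℝ Ψ (p θ) ∘L fderiv ℝ p θ := by
    have h := c.hasFDerivAt.add ((hΨ (p θ)).hasFDerivAt.comp θ (hpd θ).hasFDerivAt)
    exact (h.congr_of_eventuallyEq (Eventually.of_forall hp)).fderiv
  have h1 : ‖fderiv ℝ Ψ (p θ)‖ ≤ 1 / 2 := by
    simpa using norm_fderiv_le_of_lipschitz ℝ hlip
  have h2 : ‖fderiv ℝ p θ‖ ≤ ‖c‖ + 1 / 2 * ‖fderiv ℝ p θ‖ := by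
    conv_lhs => rw [hd]
    refine (norm_add_le _ _).trans ?_
    gcongr
    exact (ContinuousLinearMap.opNorm_comp_le _ _).trans (by gcongr)
  linarith

/-- Differentiate the fixed-point equation twice: the term containing $D^2p$ on the right carries a
factor at most $1/2$ and is absorbed on the left. -/
theorem norm_fderiv_fderiv_le_of_eq_add_contraction (hΨ : ContDiff ℝ 2 Ψ)
    (hlip : LipschitzWith (1 / 2) Ψ) (hp : ∀ θ, p θ = c θ + Ψ (p θ)) (hpd : ContDiff ℝ 2 p)
    (θ : E) : ‖fderiv ℝ (fderiv ℝ p) θ‖ ≤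
      2 * (‖fderiv ℝ (fderiv ℝ Ψ) (p θ)‖ * ‖fderiv ℝ p θ‖ ^ 2) := by
  have hΨ1 : Differentiable ℝ Ψ := hΨ.differentiable (by simp)
  have hp1 : Differentiable ℝ p := hpd.differentiable (by simp)
  have hΨ2 : Differentiable ℝ (fderiv ℝ Ψ) :=
    (hΨ.fderiv_right (m := 1) (by norm_num)).differentiable (by simp)
  have hp2 : Differentiable ℝ (fderiv ℝ p) :=
    (hpd.fderiv_right (m := 1) (by norm_num)).differentiable (by simp)
  have hd (θ : E) : fderiv ℝ p θ = c + fderiv ℝ Ψ (p θ) ∘L fderiv ℝ p θ := by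
    have h := c.hasFDerivAt.add ((hΨ1 (p θ)).hasFDerivAt.comp θ (hp1 θ).hasFDerivAt)
    exact (h.congr_of_eventuallyEq (Eventually.of_forall hp)).fderiv
  have h1 : ‖fderiv ℝ Ψ (p θ)‖ ≤ 1 / 2 := by
    simpa using norm_fderiv_le_of_lipschitz ℝ hlip
  have hdd (h k : E) : fderiv ℝ (fderiv ℝ p) θ h k =
      fderiv ℝ (fderiv ℝ Ψ) (p θ) (fderiv ℝ p θ h) (fderiv ℝ p θ k) +
        fderiv ℝ Ψ (p θ) (fderiv ℝ (fderiv ℝ p) θ h k) := by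
    have h3 := ((((hΨ2 (p θ)).hasFDerivAt.comp θ (hp1 θ).hasFDerivAt).clm_comp
      (hp2 θ).hasFDerivAt).const_add c).congr_of_eventuallyEq (Eventually.of_forall hd)
    conv_lhs => rw [h3.fderiv]
    simp [add_comm]
  have key : ‖fderiv ℝ (fderiv ℝ p) θ‖ ≤ ‖fderiv ℝ (fderiv ℝ Ψ) (p θ)‖ * ‖fderiv ℝ p θ‖ ^ 2 +
      1 / 2 * ‖fderiv ℝ (fderiv ℝ p) θ‖ := by
    refine ContinuousLinearMap.opNorm_le_bound₂ _ (by positivity) fun h k => ?_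
    rw [hdd]
    calc _ ≤ ‖fderiv ℝ (fderiv ℝ Ψ) (p θ)‖ * (‖fderiv ℝ p θ‖ * ‖h‖) * (‖fderiv ℝ p θ‖ * ‖k‖) +
          1 / 2 * (‖fderiv ℝ (fderiv ℝ p) θ‖ * ‖h‖ * ‖k‖) := by
          refine (norm_add_le _ _).trans (add_le_add ?_ ?_)
          · refine (ContinuousLinearMap.le_opNorm₂ _ _ _).trans ?_
            gcongr <;> exact ContinuousLinearMap.le_opNorm _ _
          · refine (ContinuousLinearMap.le_opNorm _ _).trans ?_
            gcongr
            exact ContinuousLinearMap.le_opNorm₂ _ _ _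
      _ = _ := by ring
  linarith

end FixedPoint

/-! ### Second derivatives of squared norms, and the integral as an $L^2$ norm -/

section NormSq

variable {E X H : Type*} [NormedAddCommGroup E] [NormedSpace ℝ E] [NormedAddCommGroup X]
  [NormedSpace ℝ X] [NormedAddCommGroup H] [InnerProductSpace ℝ H]

theorem norm_fderiv_fderiv_norm_sq_le {q : E → H} (hq : ContDiff ℝ 2 q) (θ : E) :
    ‖fderiv ℝ (fderiv ℝ fun θ => ‖q θ‖ ^ 2) θ‖ ≤
      2 * (‖fderiv ℝ q θ‖ ^ 2 + ‖q θ‖ * ‖fderiv ℝ (fderiv ℝ q) θ‖) := by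
  have hq1 : Differentiable ℝ q := hq.differentiable (by simp)
  have hq2 : Differentiable ℝ (fderiv ℝ q) :=
    (hq.fderiv_right (m := 1) (by norm_num)).differentiable (by simp)
  have hd (θ : E) : fderiv ℝ (fun θ => ‖q θ‖ ^ 2) θ = (2 : ℝ) • (innerSL ℝ (q θ) ∘L fderiv ℝ q θ) := by
    rw [(hq1 θ).hasFDerivAt.norm_sq.fderiv]
    ext h
    simp [two_smul]
  have hdd (h k : E) : fderiv ℝ (fderiv ℝ fun θ => ‖q θ‖ ^ 2) θ h k =
      2 * (inner ℝ (fderiv ℝ q θ h) (fderiv ℝ q θ k) +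
        inner ℝ (q θ) (fderiv ℝ (fderiv ℝ q) θ h k)) := by
    have h1 := ((((innerSL ℝ (E := H)).hasFDerivAt.comp θ (hq1 θ).hasFDerivAt).clm_comp
      (hq2 θ).hasFDerivAt).const_smul (2 : ℝ)).congr_of_eventuallyEq (Eventually.of_forall hd)
    rw [h1.fderiv]
    rw [add_comm (inner ℝ _ _)]
    rfl
  refine ContinuousLinearMap.opNorm_le_bound₂ _ (by positivity) fun h k => ?_
  rw [hdd, norm_mul, Real.norm_ofNat]
  calc _ ≤ 2 * ((‖fderiv ℝ q θ‖ * ‖h‖) * (‖fderiv ℝ q θ‖ * ‖k‖) +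
        ‖q θ‖ * (‖fderiv ℝ (fderiv ℝ q) θ‖ * ‖h‖ * ‖k‖)) := by
        gcongr
        refine (norm_add_le _ _).trans (add_le_add ?_ ?_)
        · refine (norm_inner_le_norm _ _).trans ?_
          gcongr <;> exact ContinuousLinearMap.le_opNorm _ _
        · refine (norm_inner_le_norm _ _).trans ?_
          gcongr
          exact ContinuousLinearMap.le_opNorm₂ _ _ _
    _ = _ := by ring

theorem norm_fderiv_fderiv_norm_clm_comp_sub_sq_le {p : E → X} (hp : ContDiff ℝ 2 p)
    (M : X →L[ℝ] H) (k : H) (θ : E) :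
    ‖fderiv ℝ (fderiv ℝ fun θ => ‖M (p θ) - k‖ ^ 2) θ‖ ≤
      2 * ((‖M‖ * ‖fderiv ℝ p θ‖) ^ 2 +
        ‖M (p θ) - k‖ * (‖M‖ * ‖fderiv ℝ (fderiv ℝ p) θ‖)) := by
  have hp1 : Differentiable ℝ p := hp.differentiable (by simp)
  have hp2 : Differentiable ℝ (fderiv ℝ p) :=
    (hp.fderiv_right (m := 1) (by norm_num)).differentiable (by simp)
  have hq : ContDiff ℝ 2 fun θ => M (p θ) - k := (M.contDiff.comp hp).sub contDiff_const
  have hd (θ : E) : fderiv ℝ (fun θ => M (p θ) - k) θ = M ∘L fderiv ℝ p θ :=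
    ((M.hasFDerivAt.comp θ (hp1 θ).hasFDerivAt).sub_const k).fderiv
  have hdd : fderiv ℝ (fderiv ℝ fun θ => M (p θ) - k) θ =
      ContinuousLinearMap.compL ℝ E X H M ∘L fderiv ℝ (fderiv ℝ p) θ := by
    rw [funext hd]
    exact ((ContinuousLinearMap.compL ℝ E X H M).hasFDerivAt.comp θ (hp2 θ).hasFDerivAt).fderiv
  refine (norm_fderiv_fderiv_norm_sq_le hq θ).trans ?_
  gcongr
  · rw [hd]
    exact ContinuousLinearMap.opNorm_comp_le _ _
  · rw [hdd]
    refine (ContinuousLinearMap.opNorm_comp_le _ _).trans ?_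
    gcongr
    refine ContinuousLinearMap.opNorm_le_bound _ (norm_nonneg _) fun g => ?_
    exact ContinuousLinearMap.opNorm_comp_le _ _

end NormSq

open MeasureTheory

universe u

/-- The squared norm of an affine image of a fixed point of a contractive superposition operator
is `C²` in the parameter, and its second derivative is controlled by the second derivative of the
nonlinearity along the fixed point. -/
theorem contDiff_and_norm_fderiv_fderiv_norm_sq_le_of_fixedPoint {α : Type*} [TopologicalSpace α]
    [CompactSpace α] {E : Type u} [NormedAddCommGroup E] [NormedSpace ℝ E] [CompleteSpace E]
    {H : Type*} [NormedAddCommGroup H] [InnerProductSpace ℝ H]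
    (A B : C(α, E) →L[ℝ] C(α, E)) {f : C(E, E)} (hf : ContDiff ℝ 2 f)
    (hlip : LipschitzWith (1 / 2) fun v => B (f.comp (A v))) (c : E →L[ℝ] C(α, E))
    {p : E → C(α, E)} (hp : ∀ θ, p θ = c θ + B (f.comp (A (p θ))))
    (M : C(α, E) →L[ℝ] H) (k : H) :
    ContDiff ℝ 2 (fun θ => ‖M (p θ) - k‖ ^ 2) ∧
      ∃ C, 0 ≤ C ∧ ∀ θ e, 0 ≤ e → (∀ t, ‖fderiv ℝ (fderiv ℝ f) (A (p θ) t)‖ ≤ e) →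
        ‖fderiv ℝ (fderiv ℝ fun θ => ‖M (p θ) - k‖ ^ 2) θ‖ ≤ C * (1 + ‖M (p θ) - k‖ * e) := by
  have hΨ : ContDiff ℝ 2 fun v => B (f.comp (A v)) :=
    B.contDiff.comp ((ContinuousMap.contDiff_comp (n := 2) hf).comp A.contDiff)
  have hpd : ContDiff ℝ 2 p := contDiff_of_eq_add_contraction (by simp) hΨ hlip hp
  refine ⟨((M.contDiff.comp hpd).sub contDiff_const).norm_sq ℝ, ?_⟩
  obtain ⟨C₁, hC₁, hC⟩ := ContinuousMap.exists_norm_fderiv_fderiv_comp_le A B hf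
  set D := 2 * ‖c‖ with hD
  have hD0 : 0 ≤ D := by positivity
  refine ⟨2 * ((‖M‖ * D) ^ 2 + ‖M‖ * (2 * (C₁ * D ^ 2))), by positivity, fun θ e he hθ => ?_⟩
  have h1 : ‖fderiv ℝ p θ‖ ≤ D := norm_fderiv_le_of_eq_add_contraction
    (hΨ.differentiable (by simp)) hlip hp (hpd.differentiable (by simp)) θ
  have h2 : ‖fderiv ℝ (fderiv ℝ p) θ‖ ≤ 2 * (C₁ * e * D ^ 2) := by
    refine (norm_fderiv_fderiv_le_of_eq_add_contraction hΨ hlip hp hpd θ).trans ?_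
    gcongr
    exact hC _ _ he hθ
  refine (norm_fderiv_fderiv_norm_clm_comp_sub_sq_le hpd M k θ).trans ?_
  have h3 : 0 ≤ (‖M‖ * D) ^ 2 * (‖M (p θ) - k‖ * e) := by positivity
  have h4 : 0 ≤ ‖M‖ * (2 * (C₁ * D ^ 2)) := by positivity
  calc _ ≤ 2 * ((‖M‖ * D) ^ 2 + ‖M (p θ) - k‖ * (‖M‖ * (2 * (C₁ * e * D ^ 2)))) := by gcongr
    _ ≤ _ := by nlinarith

/-- Lebesgue measure on the subtype `[0, T]`. -/
noncomputable def intervalMeasure (T : ℝ) : Measure (Icc 0 T) :=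
  (volume.restrict (Icc 0 T)).comap Subtype.val

instance (T : ℝ) : IsFiniteMeasure (intervalMeasure T) := by
  unfold intervalMeasure
  infer_instance

/-- This turns the integral defining $V$ into a squared Hilbert norm, so no differentiation under
the integral sign is needed. -/
theorem norm_toLp_sq_eq_intervalIntegral {E : Type*} [NormedAddCommGroup E] [InnerProductSpace ℝ E]
    {T : ℝ} (hT : 0 ≤ T) (w : C(Icc 0 T, E)) {g : ℝ → ℝ} (hg : ∀ t : Icc 0 T, ‖w t‖ ^ 2 = g t) :
    ‖ContinuousMap.toLp 2 (intervalMeasure T) ℝ w‖ ^ 2 = ∫ t in (0 : ℝ)..T, g t := by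
  have h : ∫ t : Icc 0 T, g t ∂(intervalMeasure T) = ∫ t in Icc 0 T, g t := by
    rw [intervalMeasure, integral_subtype_comap measurableSet_Icc,
      Measure.restrict_restrict measurableSet_Icc, inter_self]
  rw [← real_inner_self_eq_norm_sq, L2.inner_def, intervalIntegral.integral_of_le hT,
    ← integral_Icc_eq_integral_Ioc, ← h]
  refine integral_congr_ae ?_
  filter_upwards [ContinuousMap.coeFn_toLp (p := 2) (𝕜 := ℝ) (intervalMeasure T) w] with t ht
  rw [ht, real_inner_self_eq_norm_sq, hg]

/-! ### Integral curves of a globally Lipschitz field -/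

section Flow

variable {E : Type u} [NormedAddCommGroup E] [NormedSpace ℝ E] {f : E → E} {L : NNReal}

theorem IsIntegralCurveOn.eqOn_Ici (hf : LipschitzWith L f) {x y : ℝ → E}
    (hx : IsIntegralCurveOn x (fun _ => f) (Ici 0)) (hy : IsIntegralCurveOn y (fun _ => f) (Ici 0))
    (h0 : x 0 = y 0) {t : ℝ} (ht : 0 ≤ t) : x t = y t :=
  ODE_solution_unique (v := fun _ => f) (K := L) (fun _ => hf)
    (hx.continuousOn.mono Icc_subset_Ici_self)
    (fun τ hτ => (hx τ hτ.1).mono (Ici_subset_Ici.2 hτ.1))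
    (hy.continuousOn.mono Icc_subset_Ici_self)
    (fun τ hτ => (hy τ hτ.1).mono (Ici_subset_Ici.2 hτ.1)) h0 ⟨ht, le_rfl⟩

/-- Grönwall's inequality for the time-reversed curve `τ ↦ x (t - τ)`: a trajectory cannot approach
an equilibrium faster than $e^{-Lt}$. -/
theorem IsIntegralCurveOn.exp_neg_mul_norm_sub_le (hf : LipschitzWith L f) {z : E} (hz : f z = 0)
    {x : ℝ → E} (hx : IsIntegralCurveOn x (fun _ => f) (Ici 0)) {t : ℝ} (ht : 0 ≤ t) :
    Real.exp (-L * t) * ‖x 0 - z‖ ≤ ‖x t - z‖ := by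
  have h := norm_le_gronwallBound_of_norm_deriv_right_le (f := fun τ => x (t - τ) - z)
    (f' := fun τ => -f (x (t - τ))) (δ := ‖x t - z‖) (K := L) (ε := 0) (a := 0) (b := t)
    ((hx.continuousOn.comp (by fun_prop) fun τ hτ => sub_nonneg.2 hτ.2).sub continuousOn_const)
    (fun τ hτ => by
      have h1 : HasDerivAt x (f (x (t - τ))) (t - τ) :=
        (hx (t - τ) (sub_nonneg.2 hτ.2.le)).hasDerivAt (Ici_mem_nhds (sub_pos.2 hτ.2))
      have h2 := h1.scomp τ ((hasDerivAt_id τ).const_sub t)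
      simpa using (h2.sub_const z).hasDerivWithinAt)
    (by simp)
    (fun τ _ => by
      have h3 := hf.dist_le_mul (x (t - τ)) z
      rw [hz, dist_zero_right, dist_eq_norm] at h3
      simpa using h3)
    t ⟨ht, le_rfl⟩
  rw [gronwallBound_ε0] at h
  simp only [sub_self, sub_zero] at h
  calc Real.exp (-L * t) * ‖x 0 - z‖
      ≤ Real.exp (-L * t) * (‖x t - z‖ * Real.exp (L * t)) := by gcongr
    _ = ‖x t - z‖ := by
      rw [mul_left_comm, ← Real.exp_add]
      simp

variable [CompleteSpace E]

/-- A globally Lipschitz vector field has an integral curve on `[0, ∞)` through every point. -/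
theorem exists_isIntegralCurveOn_Ici (hf : LipschitzWith L f) (x₀ : E) :
    ∃ x : ℝ → E, x 0 = x₀ ∧ IsIntegralCurveOn x (fun _ => f) (Ici 0) := by
  choose x hx0 hx using fun n : ℕ =>
    ContinuousMap.exists_isIntegralCurveOn_Icc (f := ⟨f, hf.continuous⟩) n.cast_nonneg hf x₀
  have huniq {m n : ℕ} (hmn : m ≤ n) {t : ℝ} (ht : t ∈ Icc 0 (m : ℝ)) : x m t = x n t := by
    have hsub : Icc 0 (m : ℝ) ⊆ Icc 0 (n : ℝ) := Icc_subset_Icc_right (by exact_mod_cast hmn)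
    exact ODE_solution_unique (v := fun _ => f) (K := L) (a := 0) (b := m) (fun _ => hf)
      (fun τ hτ => (hx m τ hτ).continuousAt.continuousWithinAt)
      (fun τ hτ => (hx m τ ⟨hτ.1, hτ.2.le⟩).hasDerivWithinAt)
      (fun τ hτ => (hx n τ (hsub hτ)).continuousAt.continuousWithinAt)
      (fun τ hτ => (hx n τ (hsub ⟨hτ.1, hτ.2.le⟩)).hasDerivWithinAt)
      ((hx0 m).trans (hx0 n).symm) ht
  have heq {n : ℕ} {t : ℝ} (ht : t ∈ Icc 0 (n : ℝ)) : x ⌈t⌉₊ t = x n t :=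
    huniq (Nat.ceil_le.2 ht.2) ⟨ht.1, Nat.le_ceil t⟩
  -- By uniqueness the solutions on the intervals $[0,n]$ agree; choosing `n` strictly above `t`
  -- gives agreement near `t`, as the derivative requires.
  refine ⟨fun t => x ⌈t⌉₊ t, by simp [hx0], fun t ht => ?_⟩
  obtain ⟨n, hn⟩ := exists_nat_gt t
  have ht' : t ∈ Icc 0 (n : ℝ) := ⟨ht, hn.le⟩
  have hd := (hx n t ht').hasDerivWithinAt (s := Ici 0)
  simp only [heq ht']
  refine hd.congr_of_eventuallyEq ?_ (heq ht')
  filter_upwards [self_mem_nhdsWithin, mem_nhdsWithin_of_mem_nhds (Iio_mem_nhds hn)] with τ h0 h1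
  exact heq ⟨h0, le_of_lt h1⟩

end Flow

/-! ### Hessians and second Fréchet derivatives -/

section Hessian

variable {d : ℕ}

theorem inner_gradient_eq_fderiv (g : EuclideanSpace ℝ (Fin d) → ℝ)
    (θ h : EuclideanSpace ℝ (Fin d)) : inner ℝ (gradient g θ) h = fderiv ℝ g θ h := by
  rw [← toDual_gradient, InnerProductSpace.toDual_apply_apply]

/-- The gradient is the derivative followed by the Riesz isometry, which preserves operator norms.
-/
theorem norm_hessian_eq {g : EuclideanSpace ℝ (Fin d) → ℝ} {θ : EuclideanSpace ℝ (Fin d)}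
    (hg : DifferentiableAt ℝ (fderiv ℝ g) θ) :
    ‖hessian g θ‖ = ‖fderiv ℝ (fderiv ℝ g) θ‖ := by
  let E := EuclideanSpace ℝ (Fin d)
  let e : StrongDual ℝ E →L[ℝ] E := LinearMap.mkContinuous
    { toFun := (InnerProductSpace.toDual ℝ E).symm
      map_add' := map_add _
      map_smul' := fun c x => by simp }
    1 fun x => by
      rw [one_mul]
      exact ((InnerProductSpace.toDual ℝ E).symm.norm_map x).le
  have he (x : StrongDual ℝ E) : ‖e x‖ = ‖x‖ := (InnerProductSpace.toDual ℝ E).symm.norm_map x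
  have h : hessian g θ = e ∘L fderiv ℝ (fderiv ℝ g) θ :=
    (e.hasFDerivAt.comp θ hg.hasFDerivAt).fderiv
  rw [h]
  exact ContinuousLinearMap.opNorm_ext _ _ fun x => he _

theorem EuclideanSpace.norm_le_sum_norm_apply (y : EuclideanSpace ℝ (Fin d)) :
    ‖y‖ ≤ ∑ i, ‖y i‖ := by
  conv_lhs => rw [← (EuclideanSpace.basisFun (Fin d) ℝ).sum_repr y]
  refine (norm_sum_le _ _).trans (Finset.sum_le_sum fun i _ => ?_)
  rw [norm_smul, OrthonormalBasis.norm_eq_one, mul_one, EuclideanSpace.basisFun_repr]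

theorem norm_fderiv_fderiv_le_sum_norm_hessian
    {f : EuclideanSpace ℝ (Fin d) → EuclideanSpace ℝ (Fin d)} (hf : ContDiff ℝ 2 f)
    (θ : EuclideanSpace ℝ (Fin d)) :
    ‖fderiv ℝ (fderiv ℝ f) θ‖ ≤ ∑ i, ‖hessian (fun φ => f φ i) θ‖ := by
  let E := EuclideanSpace ℝ (Fin d)
  have hf1 : Differentiable ℝ f := hf.differentiable (by simp)
  have hf2 : Differentiable ℝ (fderiv ℝ f) :=
    (hf.fderiv_right (m := 1) (by norm_num)).differentiable (by simp)
  let π (i : Fin d) : E →L[ℝ] ℝ := EuclideanSpace.proj i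
  have hd (i : Fin d) : fderiv ℝ (fun φ => f φ i) = fun φ => π i ∘L fderiv ℝ f φ :=
    funext fun φ => ((π i).hasFDerivAt.comp φ (hf1 φ).hasFDerivAt).fderiv
  have hdd (i : Fin d) : HasFDerivAt (fderiv ℝ fun φ => f φ i)
      (ContinuousLinearMap.compL ℝ E E ℝ (π i) ∘L fderiv ℝ (fderiv ℝ f) θ) θ := by
    rw [hd i]
    exact (ContinuousLinearMap.compL ℝ E E ℝ (π i)).hasFDerivAt.comp θ (hf2 θ).hasFDerivAt
  have hi (i : Fin d) (h k : E) : ‖fderiv ℝ (fderiv ℝ f) θ h k i‖ ≤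
      ‖hessian (fun φ => f φ i) θ‖ * ‖h‖ * ‖k‖ := by
    rw [norm_hessian_eq (hdd i).differentiableAt]
    have h1 : fderiv ℝ (fderiv ℝ f) θ h k i = fderiv ℝ (fderiv ℝ fun φ => f φ i) θ h k := by
      rw [(hdd i).fderiv]
      rfl
    rw [h1]
    exact ContinuousLinearMap.le_opNorm₂ _ _ _
  refine ContinuousLinearMap.opNorm_le_bound₂ _
    (Finset.sum_nonneg fun _ _ => norm_nonneg _) fun h k => ?_
  refine (EuclideanSpace.norm_le_sum_norm_apply _).trans ?_
  rw [Finset.sum_mul, Finset.sum_mul]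
  exact Finset.sum_le_sum fun i _ => hi i h k

end Hessian

/-! ### Quadratic bounds and decay of the Corless–Glielmo integral -/

section CorlessGlielmo

variable {d : ℕ} {f : EuclideanSpace ℝ (Fin d) → EuclideanSpace ℝ (Fin d)}
  {s : ℝ → EuclideanSpace ℝ (Fin d) → EuclideanSpace ℝ (Fin d)}
  {θs : EuclideanSpace ℝ (Fin d)} {μ γ κ T : ℝ} {L : NNReal}

theorem IsSolutionMap.norm_sub_le (hs : IsSolutionMap f s) (hexp : HasExponentialBound f θs μ γ)
    {t : ℝ} (ht : 0 ≤ t) (θ : EuclideanSpace ℝ (Fin d)) :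
    ‖s t θ - θs‖ ≤ μ * ‖θ - θs‖ * Real.exp (-γ * t) := by
  have h := hexp _ (hs θ).2 t ht
  simpa only [(hs θ).1] using h

theorem IsSolutionMap.exp_neg_mul_norm_sub_le (hs : IsSolutionMap f s) (hLip : LipschitzWith L f)
    (hzero : f θs = 0) {t : ℝ} (ht : 0 ≤ t) (θ : EuclideanSpace ℝ (Fin d)) :
    Real.exp (-L * t) * ‖θ - θs‖ ≤ ‖s t θ - θs‖ := by
  have h := (hs θ).2.exp_neg_mul_norm_sub_le hLip hzero ht
  simpa only [(hs θ).1] using h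

theorem IsSolutionMap.apply_apply (hs : IsSolutionMap f s) (hLip : LipschitzWith L f)
    {t h : ℝ} (ht : 0 ≤ t) (hh : 0 ≤ h) (θ : EuclideanSpace ℝ (Fin d)) :
    s t (s h θ) = s (t + h) θ := by
  refine (hs (s h θ)).2.eqOn_Ici (y := fun t => s (t + h) θ) hLip ?_ (by simp [(hs _).1]) ht
  have h1 := (hs θ).2.comp_add h
  exact IsIntegralCurveOn.mono h1 fun τ hτ => ⟨τ + h, add_nonneg hτ hh, by simp⟩

theorem IsSolutionMap.continuousOn_integrand (hs : IsSolutionMap f s) (κ : ℝ)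
    (θ θs : EuclideanSpace ℝ (Fin d)) :
    ContinuousOn (fun τ => Real.exp (2 * κ * τ) * ‖s τ θ - θs‖ ^ 2) (Ici 0) := by
  have h : ContinuousOn (fun τ => s τ θ) (Ici 0) := (hs θ).2.continuousOn
  fun_prop

theorem IsSolutionMap.corlessGlielmo_le (hs : IsSolutionMap f s)
    (hexp : HasExponentialBound f θs μ γ) (hκγ : κ ≤ γ) (hT : 0 ≤ T)
    (θ : EuclideanSpace ℝ (Fin d)) :
    corlessGlielmo s θs κ T θ ≤ T * μ ^ 2 * ‖θ - θs‖ ^ 2 := by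
  have h := intervalIntegral.integral_mono_on hT (μ := volume)
    (((hs.continuousOn_integrand κ θ θs).mono Icc_subset_Ici_self).intervalIntegrable_of_Icc hT)
    (intervalIntegrable_const (c := (μ * ‖θ - θs‖) ^ 2)) fun τ hτ => by
      calc Real.exp (2 * κ * τ) * ‖s τ θ - θs‖ ^ 2
          ≤ Real.exp (2 * γ * τ) * (μ * ‖θ - θs‖ * Real.exp (-γ * τ)) ^ 2 := by
            have := hτ.1
            gcongr
            exact hs.norm_sub_le hexp hτ.1 θ
        _ = (μ * ‖θ - θs‖) ^ 2 := by
            rw [mul_pow _ (Real.exp _), ← Real.exp_nat_mul, mul_left_comm, ← Real.exp_add]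
            norm_num
            ring_nf
            simp
  rw [intervalIntegral.integral_const, smul_eq_mul, sub_zero] at h
  calc _ ≤ _ := h
    _ = _ := by ring

theorem IsSolutionMap.le_corlessGlielmo (hs : IsSolutionMap f s) (hLip : LipschitzWith L f)
    (hzero : f θs = 0) (hκ : 0 ≤ κ) (hT : 0 ≤ T) (θ : EuclideanSpace ℝ (Fin d)) :
    T * Real.exp (-L * T) ^ 2 * ‖θ - θs‖ ^ 2 ≤ corlessGlielmo s θs κ T θ := by
  have h := intervalIntegral.integral_mono_on hT (μ := volume)
    (intervalIntegrable_const (c := (Real.exp (-L * T) * ‖θ - θs‖) ^ 2))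
    (((hs.continuousOn_integrand κ θ θs).mono Icc_subset_Ici_self).intervalIntegrable_of_Icc hT)
    fun τ hτ => by
      have h0 := hτ.1
      calc (Real.exp (-L * T) * ‖θ - θs‖) ^ 2 = 1 * (Real.exp (-L * T) * ‖θ - θs‖) ^ 2 :=
            (one_mul _).symm
        _ ≤ Real.exp (2 * κ * τ) * ‖s τ θ - θs‖ ^ 2 := by
            gcongr
            · exact Real.one_le_exp (by positivity)
            · refine le_trans ?_ (hs.exp_neg_mul_norm_sub_le hLip hzero hτ.1 θ)
              gcongr 1
              refine Real.exp_le_exp.2 ?_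
              have := mul_le_mul_of_nonneg_left hτ.2 L.coe_nonneg
              linarith
  rw [intervalIntegral.integral_const, smul_eq_mul, sub_zero] at h
  calc _ = _ := by ring
    _ ≤ _ := h

/-- Along a trajectory, `corlessGlielmo` is a sliding-window integral, whose derivative is
the difference of the boundary terms minus the effect of the exponential weight. -/
theorem IsSolutionMap.hasDerivWithinAt_corlessGlielmo (hs : IsSolutionMap f s)
    (hLip : LipschitzWith L f) (hT : 0 ≤ T) (θ : EuclideanSpace ℝ (Fin d)) :
    HasDerivWithinAt (fun h => corlessGlielmo s θs κ T (s h θ))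
      (-(2 * κ) * corlessGlielmo s θs κ T θ +
        (Real.exp (2 * κ * T) * ‖s T θ - θs‖ ^ 2 - ‖θ - θs‖ ^ 2)) (Ici 0) 0 := by
  set g : ℝ → ℝ := fun τ => Real.exp (2 * κ * τ) * ‖s τ θ - θs‖ ^ 2 with hg
  -- Freezing the integrand at negative times, where `s` is arbitrary, makes its primitive
  -- differentiable at `0` from both sides.
  set G : ℝ → ℝ := fun τ => g (max τ 0) with hG
  have hGc : Continuous G :=
    (hs.continuousOn_integrand κ θ θs).comp_continuous (by fun_prop) fun τ => mem_Ici.2 (le_max_right _ _)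
  have hGg {τ : ℝ} (hτ : 0 ≤ τ) : G τ = g τ := by rw [hG]; simp [hτ]
  set F : ℝ → ℝ := fun u => ∫ τ in (0 : ℝ)..u, G τ with hF
  have hFd (u : ℝ) : HasDerivAt F (G u) u := hGc.integral_hasStrictDerivAt 0 u |>.hasDerivAt
  have hV {h : ℝ} (hh : 0 ≤ h) : corlessGlielmo s θs κ T (s h θ) =
      Real.exp (-(2 * κ) * h) * (F (h + T) - F h) := by
    have h1 : F (h + T) - F h = ∫ τ in h..(h + T), G τ :=
      intervalIntegral.integral_interval_sub_left (hGc.intervalIntegrable _ _)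
        (hGc.intervalIntegrable _ _)
    rw [h1, corlessGlielmo, ← intervalIntegral.integral_const_mul]
    have h2 := intervalIntegral.integral_comp_add_right (a := 0) (b := T)
      (fun τ => Real.exp (-(2 * κ) * h) * G τ) h
    rw [zero_add, add_comm T] at h2
    rw [← h2]
    refine intervalIntegral.integral_congr fun τ hτ => ?_
    rw [uIcc_of_le hT] at hτ
    rw [hGg (add_nonneg hτ.1 hh), hs.apply_apply hLip hτ.1 hh, hg, ← mul_assoc, ← Real.exp_add]
    congr 2
    ring
  have hd : HasDerivAt (fun h => Real.exp (-(2 * κ) * h) * (F (h + T) - F h))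
      (-(2 * κ) * (F T - F 0) + (G T - G 0)) 0 := by
    have h1 : HasDerivAt (fun h => Real.exp (-(2 * κ) * h)) (-(2 * κ)) 0 := by
      simpa using ((hasDerivAt_id (0 : ℝ)).const_mul (-(2 * κ))).exp
    have h2 : HasDerivAt (fun h => F (h + T)) (G T) 0 := by
      refine HasDerivAt.comp_add_const 0 T ?_
      rw [zero_add]
      exact hFd T
    refine (h1.mul (h2.sub (hFd 0))).congr_deriv ?_
    simp
  have h0 : F T - F 0 = corlessGlielmo s θs κ T θ := by
    have h := hV le_rfl
    rw [(hs θ).1] at h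
    rw [h]
    simp
  have hG0 : G 0 = ‖θ - θs‖ ^ 2 := by rw [hGg le_rfl, hg]; simp [(hs θ).1]
  rw [h0, hG0, hGg hT] at hd
  exact hd.hasDerivWithinAt.congr (fun h hh => hV hh) (hV le_rfl)

/-- The condition on `T` says $\mu e^{-(\gamma-\kappa)T}\le 1$, so $e^{\kappa
T}\|s(T,\theta)-\theta^*\|\le\|\theta-\theta^*\|$ and the boundary terms are nonpositive. -/
theorem IsSolutionMap.orbitalDerivative_corlessGlielmo_le (hs : IsSolutionMap f s)
    (hLip : LipschitzWith L f) (hexp : HasExponentialBound f θs μ γ) (hμ : 1 ≤ μ) (hκγ : κ < γ)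
    (hT : 0 ≤ T) (hTμ : Real.log μ / (γ - κ) ≤ T)
    (hV : Differentiable ℝ (corlessGlielmo s θs κ T)) (θ : EuclideanSpace ℝ (Fin d)) :
    orbitalDerivative f (corlessGlielmo s θs κ T) θ ≤
      -(2 * κ) * corlessGlielmo s θs κ T θ := by
  have h1 : HasDerivWithinAt (fun h => corlessGlielmo s θs κ T (s h θ))
      (fderiv ℝ (corlessGlielmo s θs κ T) θ (f θ)) (Ici 0) 0 := by
    have hc : HasDerivWithinAt (fun t => s t θ) (f θ) (Ici 0) 0 := by
      have h := (hs θ).2 0 self_mem_Ici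
      simp only [(hs θ).1] at h
      exact h
    have hVd : HasFDerivAt (corlessGlielmo s θs κ T) (fderiv ℝ (corlessGlielmo s θs κ T) θ)
        (s 0 θ) := by
      rw [(hs θ).1]
      exact (hV θ).hasFDerivAt
    exact hVd.comp_hasDerivWithinAt 0 hc
  have h2 := (uniqueDiffOn_Ici (0 : ℝ) 0 self_mem_Ici).eq_deriv _ h1
    (hs.hasDerivWithinAt_corlessGlielmo hLip hT θ)
  rw [orbitalDerivative, inner_gradient_eq_fderiv, h2]
  have h3 : μ ≤ Real.exp ((γ - κ) * T) := by
    rw [← Real.log_le_iff_le_exp (by linarith), mul_comm]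
    exact (div_le_iff₀ (sub_pos.2 hκγ)).1 hTμ
  have h4 : Real.exp (κ * T) * ‖s T θ - θs‖ ≤ ‖θ - θs‖ := by
    calc Real.exp (κ * T) * ‖s T θ - θs‖
        ≤ Real.exp (κ * T) * (Real.exp ((γ - κ) * T) * ‖θ - θs‖ * Real.exp (-γ * T)) := by
          gcongr
          exact (hs.norm_sub_le hexp hT θ).trans (by gcongr)
      _ = Real.exp (κ * T + (γ - κ) * T + -γ * T) * ‖θ - θs‖ := by
          rw [Real.exp_add, Real.exp_add]
          ring
      _ = ‖θ - θs‖ := by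
          ring_nf
          simp
  have h5 : Real.exp (2 * κ * T) * ‖s T θ - θs‖ ^ 2 ≤ ‖θ - θs‖ ^ 2 := by
    have h6 : Real.exp (2 * κ * T) = Real.exp (κ * T) ^ 2 := by
      rw [← Real.exp_nat_mul]
      push_cast
      ring_nf
    rw [h6, ← mul_pow]
    gcongr
  linarith

end CorlessGlielmo

/-- The continuous linear map sending a vector to the corresponding constant function. -/
noncomputable def ContinuousMap.constCLM (α E : Type*) [TopologicalSpace α] [CompactSpace α]
    [NormedAddCommGroup E] [NormedSpace ℝ E] : E →L[ℝ] C(α, E) :=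
  LinearMap.mkContinuous
    { toFun := ContinuousMap.const α
      map_add' := fun _ _ => rfl
      map_smul' := fun _ _ => rfl }
    1 fun x => (ContinuousMap.norm_le _ (by positivity)).2 fun _ => (one_mul ‖x‖).ge

/-! ### Smoothness and the global Hessian bound -/

section CorlessGlielmo

variable {d : ℕ} {f : EuclideanSpace ℝ (Fin d) → EuclideanSpace ℝ (Fin d)}
  {s : ℝ → EuclideanSpace ℝ (Fin d) → EuclideanSpace ℝ (Fin d)}
  {θs : EuclideanSpace ℝ (Fin d)} {μ γ κ T : ℝ} {L : NNReal} {K : ℝ}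

/-- Smoothness of `corlessGlielmo`, with a bound of its second derivative by the second derivative
of the vector field along the trajectory. -/
theorem IsSolutionMap.contDiff_corlessGlielmo (hs : IsSolutionMap f s) (hf : ContDiff ℝ 2 f)
    (hLip : LipschitzWith L f) (hT : 0 ≤ T) :
    ContDiff ℝ 2 (corlessGlielmo s θs κ T) ∧
      ∃ C, 0 ≤ C ∧ ∀ θ e, 0 ≤ e →
        (∀ t ∈ Icc 0 T, ‖fderiv ℝ (fderiv ℝ f) (s t θ)‖ ≤ e) →
        ‖fderiv ℝ (fderiv ℝ (corlessGlielmo s θs κ T)) θ‖ ≤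
          C * (1 + √(corlessGlielmo s θs κ T θ) * e) := by
  let E := EuclideanSpace ℝ (Fin d)
  -- This gives `L / r ≤ 1 / 2`; the summand `1` keeps `r` positive when `L = 0`.
  let r : NNReal := 2 * L + 1
  let f₀ : C(E, E) := ⟨f, hLip.continuous⟩
  have hr : 0 < r := by positivity
  have hLr : L / r ≤ 1 / 2 := by
    rw [div_le_div_iff₀ hr two_pos, one_mul, mul_comm]
    exact le_self_add
  let A := ContinuousMap.weight E (ContinuousMap.expWeight T r)
  let A' := ContinuousMap.weight E (ContinuousMap.expWeight T (-r))
  let B := A' ∘L ContinuousMap.primitive E hT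
  let c := A' ∘L ContinuousMap.constCLM (Icc 0 T) E
  let p (θ : E) : C(Icc 0 T, E) := ⟨fun t => Real.exp (-r * t) • s t θ, by
    have h : Continuous fun t : Icc 0 T => s t θ :=
      (hs θ).2.continuousOn.comp_continuous continuous_subtype_val fun t => t.2.1
    exact (by fun_prop : Continuous fun t : Icc 0 T => Real.exp (-r * t)).smul h⟩
  have hlip : LipschitzWith (1 / 2) fun v => B (f₀.comp (A v)) :=
    (ContinuousMap.lipschitzWith_weightedPicard hT hr (f := f₀) hLip).weaken hLr
  have hp (θ : E) : p θ = c θ + B (f₀.comp (A (p θ))) := by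
    have h := ContinuousMap.eq_add_weightedPicard_of_isIntegralCurveOn hT r (f := f₀) (hs θ).2
      (v := p θ) fun t => rfl
    simp only [(hs θ).1] at h
    exact h
  have hAp (θ : E) (t : Icc 0 T) : A (p θ) t = s t θ := by
    change Real.exp (r * t) • Real.exp (-r * t) • s t θ = s t θ
    rw [smul_smul, ← Real.exp_add]
    simp
  let Λ := ContinuousMap.toLp (E := E) 2 (intervalMeasure T) ℝ
  -- The exponent `r` undoes the weight in `p`, and `κ` supplies the square root of the factor
  -- $e^{2\kappa t}$.
  let M := Λ ∘L ContinuousMap.weight E (ContinuousMap.expWeight T (κ + r))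
  let k := Λ (ContinuousMap.weight E (ContinuousMap.expWeight T κ) (ContinuousMap.const _ θs))
  have hV (θ : E) : ‖M (p θ) - k‖ ^ 2 = corlessGlielmo s θs κ T θ := by
    have h1 : M (p θ) - k = Λ (ContinuousMap.weight E (ContinuousMap.expWeight T (κ + r)) (p θ) -
        ContinuousMap.weight E (ContinuousMap.expWeight T κ) (ContinuousMap.const _ θs)) :=
      (map_sub Λ _ _).symm
    rw [h1]
    refine norm_toLp_sq_eq_intervalIntegral hT _ fun t => ?_
    have h2 : Real.exp ((κ + r) * t) • Real.exp (-r * t) • s t θ - Real.exp (κ * t) • θs =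
        Real.exp (κ * t) • (s t θ - θs) := by
      rw [smul_smul, ← Real.exp_add, smul_sub]
      ring_nf
    change ‖Real.exp ((κ + r) * t) • Real.exp (-r * t) • s t θ - Real.exp (κ * t) • θs‖ ^ 2 = _
    rw [h2, norm_smul, mul_pow, Real.norm_eq_abs, Real.abs_exp, ← Real.exp_nat_mul]
    push_cast
    ring_nf
  have hVf : (fun θ => ‖M (p θ) - k‖ ^ 2) = corlessGlielmo s θs κ T := funext hV
  have hsqrt (θ : E) : √(corlessGlielmo s θs κ T θ) = ‖M (p θ) - k‖ := by
    rw [← hV, Real.sqrt_sq (norm_nonneg _)]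
  obtain ⟨h1, C, hC, h2⟩ := contDiff_and_norm_fderiv_fderiv_norm_sq_le_of_fixedPoint A B
    (f := f₀) hf hlip c hp M k
  rw [hVf] at h1 h2
  refine ⟨h1, C, hC, fun θ e he hθ => ?_⟩
  rw [hsqrt]
  exact h2 θ e he fun t => by
    rw [hAp]
    exact hθ t t.2

theorem IsSolutionMap.isLyapunovWithBoundedHessian_corlessGlielmo (hs : IsSolutionMap f s)
    (hzero : f θs = 0) (hf : ContDiff ℝ 2 f) (hLip : LipschitzWith L f)
    (hHess : ∀ (i : Fin d) (θ : EuclideanSpace ℝ (Fin d)),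
      ‖hessian (fun φ => f φ i) θ‖ * ‖θ - θs‖ ≤ K)
    (hexp : HasExponentialBound f θs μ γ) (hμ : 1 ≤ μ) (hκ : 0 < κ) (hκγ : κ < γ)
    (hT : 0 < T) (hTμ : Real.log μ / (γ - κ) ≤ T) :
    IsLyapunovWithBoundedHessian f θs (corlessGlielmo s θs κ T) := by
  obtain ⟨hVC, C, hC, hVH⟩ := hs.contDiff_corlessGlielmo (θs := θs) (κ := κ) hf hLip hT.le
  set a := T * Real.exp (-L * T) ^ 2 with ha
  have ha0 : 0 < a := by positivity
  have hlow (θ) : a * ‖θ - θs‖ ^ 2 ≤ corlessGlielmo s θs κ T θ :=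
    hs.le_corlessGlielmo hLip hzero hκ.le hT.le θ
  have hup (θ) : corlessGlielmo s θs κ T θ ≤ T * μ ^ 2 * ‖θ - θs‖ ^ 2 :=
    hs.corlessGlielmo_le hexp hκγ.le hT.le θ
  have hD2 (θ) : ‖fderiv ℝ (fderiv ℝ f) θ‖ * ‖θ - θs‖ ≤ d * K := by
    calc _ ≤ (∑ i, ‖hessian (fun φ => f φ i) θ‖) * ‖θ - θs‖ := by
          gcongr
          exact norm_fderiv_fderiv_le_sum_norm_hessian hf θ
      _ ≤ ∑ _i : Fin d, K := by
          rw [Finset.sum_mul]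
          exact Finset.sum_le_sum fun i _ => hHess i θ
      _ = d * K := by simp
  -- Only the product is known to be nonnegative: `K` itself may be negative when `d = 0`.
  have hdK : 0 ≤ d * K := le_trans (by positivity) (hD2 θs)
  have hbound (θ) : ‖fderiv ℝ (fderiv ℝ (corlessGlielmo s θs κ T)) θ‖ ≤
      C * (1 + √(T * μ ^ 2) * (d * K * Real.exp (L * T))) := by
    -- At the equilibrium the bound by $1/\|\theta-\theta^*\|$ is unavailable, but there the
    -- trajectory is constant and $\sqrt V=0$ removes the second term.
    rcases eq_or_ne θ θs with rfl | hθ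
    · have hst (t) (ht : t ∈ Icc 0 T) : s t θ = θ := by
        have := hs.norm_sub_le hexp ht.1 θ
        simpa [sub_eq_zero] using this
      have hV0 : corlessGlielmo s θ κ T θ ≤ 0 := by simpa using hup θ
      have h := hVH θ ‖fderiv ℝ (fderiv ℝ f) θ‖ (by positivity) fun t ht => by rw [hst t ht]
      rw [Real.sqrt_eq_zero_of_nonpos hV0, zero_mul] at h
      exact h.trans (by gcongr; positivity)
    · have hpos : 0 < ‖θ - θs‖ := norm_pos_iff.2 (sub_ne_zero.2 hθ)
      have h := hVH θ (d * K * Real.exp (L * T) / ‖θ - θs‖) (by positivity) fun t ht => by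
        have h1 := hs.exp_neg_mul_norm_sub_le hLip hzero ht.1 θ
        have h2 : Real.exp (-L * T) * ‖θ - θs‖ ≤ ‖s t θ - θs‖ := by
          refine le_trans ?_ h1
          gcongr 1
          refine Real.exp_le_exp.2 ?_
          have := mul_le_mul_of_nonneg_left ht.2 L.coe_nonneg
          linarith
        rw [le_div_iff₀ hpos]
        calc ‖fderiv ℝ (fderiv ℝ f) (s t θ)‖ * ‖θ - θs‖
            = ‖fderiv ℝ (fderiv ℝ f) (s t θ)‖ * (Real.exp (-L * T) * ‖θ - θs‖) *
                Real.exp (L * T) := by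
              rw [mul_comm (Real.exp (-L * T)), ← mul_assoc, mul_assoc _ (Real.exp _),
                ← Real.exp_add]
              simp
          _ ≤ ‖fderiv ℝ (fderiv ℝ f) (s t θ)‖ * ‖s t θ - θs‖ * Real.exp (L * T) := by gcongr
          _ ≤ d * K * Real.exp (L * T) :=
              mul_le_mul_of_nonneg_right (hD2 _) (Real.exp_pos _).le
      refine h.trans ?_
      gcongr C * (1 + ?_)
      calc √(corlessGlielmo s θs κ T θ) * (d * K * Real.exp (L * T) / ‖θ - θs‖)
          ≤ (√(T * μ ^ 2) * ‖θ - θs‖) * (d * K * Real.exp (L * T) / ‖θ - θs‖) := by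
            gcongr
            refine (Real.sqrt_le_sqrt (hup θ)).trans (le_of_eq ?_)
            rw [Real.sqrt_mul (by positivity), Real.sqrt_sq (norm_nonneg _)]
        _ = √(T * μ ^ 2) * (d * K * Real.exp (L * T)) := by
            field_simp
  -- The decay constant comes from $\dot V\le-2\kappa V\le-2\kappa a\|\theta-\theta^*\|^2$.
  refine ⟨hVC, fun θ => le_trans (by positivity) (hlow θ), a, T * μ ^ 2, 2 * κ * a,
    C * (1 + √(T * μ ^ 2) * (d * K * Real.exp (L * T))) / 2, ha0, by positivity, by positivity,
    fun θ => ⟨hlow θ, hup θ⟩, fun θ => ?_, fun θ => ?_⟩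
  · refine (hs.orbitalDerivative_corlessGlielmo_le hLip hexp hμ hκγ hT.le hTμ
      (hVC.differentiable (by simp)) θ).trans ?_
    nlinarith [hlow θ]
  · rw [norm_hessian_eq (((hVC.fderiv_right (m := 1) (by norm_num)).differentiable (by simp)) θ)]
    linarith [hbound θ]

end CorlessGlielmo

theorem mainTheorem1 (d : ℕ)
    (f : EuclideanSpace ℝ (Fin d) → EuclideanSpace ℝ (Fin d))
    (θs : EuclideanSpace ℝ (Fin d)) (L : NNReal) (K : ℝ)
    (hzero : ∀ θ, f θ = 0 ↔ θ = θs)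
    (hC2 : ContDiff ℝ 2 f)
    (hLip : LipschitzWith L f)
    (hstable : IsGloballyExponentiallyStable f θs)
    (hHess : ∀ (i : Fin d) (θ : EuclideanSpace ℝ (Fin d)),
      ‖hessian (fun φ => f φ i) θ‖ * ‖θ - θs‖ ≤ K) :
    (∃ V : EuclideanSpace ℝ (Fin d) → ℝ, IsLyapunovWithBoundedHessian f θs V) ∧
    (∃ s : ℝ → EuclideanSpace ℝ (Fin d) → EuclideanSpace ℝ (Fin d), IsSolutionMap f s) ∧
    ∀ s : ℝ → EuclideanSpace ℝ (Fin d) → EuclideanSpace ℝ (Fin d), IsSolutionMap f s →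
      ∀ μ γ κ T : ℝ, 1 ≤ μ → 0 < γ → HasExponentialBound f θs μ γ →
        0 < κ → κ < γ → 0 < T → Real.log μ / (γ - κ) ≤ T →
        IsLyapunovWithBoundedHessian f θs (corlessGlielmo s θs κ T) := by
  have hz : f θs = 0 := (hzero θs).2 rfl
  choose x hx0 hx using exists_isIntegralCurveOn_Ici hLip
  have hs : IsSolutionMap f fun t θ => x θ t := fun θ => ⟨hx0 θ, hx θ⟩
  obtain ⟨μ, γ, hμ, hγ, hexp⟩ := hstable
  -- Any `κ` strictly between `0` and `γ` would do; the maximum with `1` keeps the horizon positive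
  -- when `μ = 1`.
  refine ⟨⟨_, hs.isLyapunovWithBoundedHessian_corlessGlielmo (κ := γ / 2)
      (T := max 1 (Real.log μ / (γ - γ / 2))) hz hC2 hLip hHess hexp hμ (by linarith)
      (by linarith) (by positivity) (le_max_right _ _)⟩, ⟨_, hs⟩, ?_⟩
  intro s hs μ γ κ T hμ _ hexp hκ hκγ hT hTμ
  exact hs.isLyapunovWithBoundedHessian_corlessGlielmo hz hC2 hLip hHess hexp hμ hκ hκγ hT hTμ
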